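/- For an integer $n\ge 1$ let $P_n(\mathbb{Z})$ be the group of homogeneous polynomials of degree $n$ in two variables $X,Y$ with integer coefficients (including $0$), on which $SL_2(\mathbb{Z})$ acts by $$(\rho_n(A)P)(X,Y)=P((X,Y)\cdot A)=P(a_{11}X+a_{21}Y,\ a_{12}X+a_{22}Y),\qquad A=\begin{pmatrix}a_{11}&a_{12}\\a_{21}&a_{22}\end{pmatrix}.$$ For $n$ even, $\rho_n$ factors through $PSL_2(\mathbb{Z})=SL_2(\mathbb{Z})/\{\pm 1\}$. Put $\eta(n)=0$ if $n\equiv 2$, $\eta(n)=1$ if $n\equiv 0$, and $\eta(n)=-1$ if $n\equiv 1 \pmod 3$. **Theorem.** Let $n\ge 2$ be even. Then the first cohomology group $H^1(PSL_2(\mathbb{Z}),P_n(\mathbb{Z}))$ is a finitely generated abelian group, and its (torsion-free) rank is $$\operatorname{rk} H^1(PSL_2(\mathbb{Z}),P_n(\mathbb{Z}))=\frac{n+1+3(-1)^{\frac n2+1}-4\eta(n)}{6}>0.$$ In particular $\operatorname{rk} H^1(PSL_2(\mathbb{Z}),P_n(\mathbb{Z}))\ge\frac{n-6}{6}$. -/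

import Mathlib

open scoped MatrixGroups

/-- The linear substitution `P(X, Y) ↦ P((X, Y) · A)`, that is
`P(X₀, X₁) ↦ P(a₀₀ X₀ + a₁₀ X₁, a₀₁ X₀ + a₁₁ X₁)`, on integral polynomials in two variables. -/
noncomputable def polySubst (A : Matrix (Fin 2) (Fin 2) ℤ) :
    MvPolynomial (Fin 2) ℤ →ₐ[ℤ] MvPolynomial (Fin 2) ℤ :=
  MvPolynomial.aeval fun j => ∑ i, MvPolynomial.C (A i j) * MvPolynomial.X i

theorem polySubst_one : polySubst 1 = AlgHom.id ℤ _ := by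
  ext j : 1
  fin_cases j <;> simp [polySubst, Matrix.one_apply]

theorem polySubst_mul (A B : Matrix (Fin 2) (Fin 2) ℤ) :
    polySubst (A * B) = (polySubst A).comp (polySubst B) := by
  ext j : 1
  simp only [polySubst, AlgHom.comp_apply, MvPolynomial.aeval_X, Matrix.mul_apply,
    Fin.sum_univ_two, map_add, map_mul, MvPolynomial.algHom_C, MvPolynomial.algebraMap_eq]
  ring

/-- `P_n(ℤ)`: the homogeneous polynomials of degree `n` in two variables with integer
coefficients (including the zero polynomial). -/
abbrev HomPoly (n : ℕ) : Type := MvPolynomial.homogeneousSubmodule (Fin 2) ℤ n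

theorem polySubst_isHomogeneous (A : Matrix (Fin 2) (Fin 2) ℤ) {n : ℕ}
    {P : MvPolynomial (Fin 2) ℤ} (hP : P.IsHomogeneous n) : (polySubst A P).IsHomogeneous n := by
  have h := hP.aeval (fun j => ∑ i, MvPolynomial.C (A i j) * MvPolynomial.X i) (n := 1)
    (fun j => MvPolynomial.IsHomogeneous.sum _ _ _ fun i _ =>
      MvPolynomial.isHomogeneous_C_mul_X (A i j) i)
  rw [one_mul] at h
  exact h

/-- The representation `ρ_n` of `SL₂(ℤ)` on `P_n(ℤ)`: `(ρ_n(A) P)(X, Y) = P((X, Y) · A)`. -/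
noncomputable def rhoSL (n : ℕ) : Representation ℤ SL(2, ℤ) (HomPoly n) where
  toFun A := (polySubst (A : Matrix (Fin 2) (Fin 2) ℤ)).toLinearMap.restrict
    fun _ hP => polySubst_isHomogeneous _ hP
  map_one' := by
    ext P : 2
    simp [LinearMap.restrict_apply, polySubst_one]
  map_mul' A B := by
    ext P : 2
    change polySubst ((A * B : SL(2, ℤ)) : Matrix (Fin 2) (Fin 2) ℤ) (P : MvPolynomial (Fin 2) ℤ) =
      polySubst (A : Matrix (Fin 2) (Fin 2) ℤ) (polySubst (B : Matrix (Fin 2) (Fin 2) ℤ) P)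
    rw [Matrix.SpecialLinearGroup.coe_mul, polySubst_mul, AlgHom.comp_apply]

/-- For `n` even, the centre of `SL₂(ℤ)` acts trivially on `P_n(ℤ)`. -/
theorem rhoSL_center {n : ℕ} (hn : Even n) {A : SL(2, ℤ)}
    (hA : A ∈ Subgroup.center SL(2, ℤ)) : rhoSL n A = 1 := by
  obtain ⟨r, hr, hA⟩ := Matrix.SpecialLinearGroup.mem_center_iff.mp hA
  have hrn : r ^ n = 1 := by
    obtain ⟨m, rfl⟩ := hn.two_dvd
    rw [Fintype.card_fin] at hr
    rw [pow_mul, hr, one_pow]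
  ext P : 2
  change polySubst (A : Matrix (Fin 2) (Fin 2) ℤ) (P : MvPolynomial (Fin 2) ℤ) = P
  have hlin : (fun j => ∑ i, MvPolynomial.C ((A : Matrix (Fin 2) (Fin 2) ℤ) i j) *
      MvPolynomial.X i) = fun j : Fin 2 => (MvPolynomial.C r * MvPolynomial.X j :
        MvPolynomial (Fin 2) ℤ) := by
    funext j
    rw [← hA, Fin.sum_univ_two, Matrix.scalar_apply, Matrix.diagonal_apply, Matrix.diagonal_apply]
    fin_cases j <;> simp
  have hP : (P : MvPolynomial (Fin 2) ℤ).IsHomogeneous n := P.2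
  rw [polySubst, hlin]
  conv_rhs => rw [MvPolynomial.as_sum (P : MvPolynomial (Fin 2) ℤ)]
  rw [MvPolynomial.aeval_def, MvPolynomial.eval₂_eq']
  refine Finset.sum_congr rfl fun d hd => ?_
  have hdeg : d 0 + d 1 = n := by
    have h := hP (MvPolynomial.mem_support_iff.mp hd)
    rw [Pi.one_def, ← Finsupp.degree_eq_weight_one, Finsupp.degree_eq_sum, Fin.sum_univ_two] at h
    exact h
  rw [MvPolynomial.monomial_eq, Finsupp.prod_fintype _ _ fun _ => pow_zero _]
  simp only [Fin.prod_univ_two, mul_pow, MvPolynomial.algebraMap_eq]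
  have hC : (MvPolynomial.C r : MvPolynomial (Fin 2) ℤ) ^ d 0 * MvPolynomial.C r ^ d 1 = 1 := by
    rw [← pow_add, hdeg, ← map_pow, hrn, map_one]
  linear_combination (MvPolynomial.C (MvPolynomial.coeff d (P : MvPolynomial (Fin 2) ℤ)) *
    MvPolynomial.X 0 ^ d 0 * MvPolynomial.X 1 ^ d 1) * hC

/-- For `n` even, the representation of `PSL₂(ℤ)` on `P_n(ℤ)` obtained by factoring `ρ_n`
through the quotient of `SL₂(ℤ)` by its centre. -/
noncomputable def rhoPSL (n : ℕ) (hn : Even n) : Representation ℤ PSL(2, ℤ) (HomPoly n) :=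
  QuotientGroup.lift (Subgroup.center SL(2, ℤ)) (rhoSL n) fun _ hA => rhoSL_center hn hA

/-- `η(n) = 0, 1, -1` according to `n ≡ 2, 0, 1 (mod 3)`. -/
def eta (n : ℕ) : ℤ :=
  if n % 3 = 2 then 0 else if n % 3 = 0 then 1 else -1

/-!
The proof reduces `H¹` to the free product structure `PSL₂(ℤ) = ℤ/2 * ℤ/3` and to two traces.

Let `s` and `u` be the classes of `S` and `S * T` in `PSL₂(ℤ)`, of orders `2` and `3`. They
generate the group, and a ping-pong argument on the sign of the product of the entries in the
first column shows that `s² = u³ = 1` are defining relations (`exists_hom_of_relations`). A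
cocycle with values in a representation `V` is the left component of a section of
`V ⋊ PSL₂(ℤ) → PSL₂(ℤ)`, so it amounts to a choice of its values at `s` and `u`, which may be arbitrary
elements of the kernels of the norms `N_s = 1 + s` and `N_u = 1 + u + u²`
(`evalCocycle_injective`, `evalCocycle_surjective`). If `V` is free of finite rank without
nonzero invariants, the coboundaries are a copy of `V`, and hence
`rk H¹ = rk (ker N_s) + rk (ker N_u) - rk V` (`finrank_H1_add`).

Since `N_s² = 2 N_s` and `N_u² = 3 N_u`, the rank of the kernel of each norm can be read off
from its trace (`mul_finrank_ker_add_trace`). On forms of even degree `n` the trace of `s` is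
`(-1) ^ (n / 2)`. The traces of `u` and `u²` are the alternating sum of binomial coefficients
along a diagonal of Pascal's triangle, a Fibonacci-like sequence of period `6` whose value at
even `n` is `η(n)` (`altDiagSum_two_mul`). Finally there are no invariants in positive degree:
invariance under the lower unipotent matrices makes `P(X, 1)` constant, so that `P = c * Y ^ n`,
and invariance under `S` then gives `c = 0` (`invariants_rhoPSL`).
-/

namespace PSLCohomology

open scoped Pointwise

/-! ### The presentation of the modular group -/

/-- The homomorphism from a cyclic group of order `m` sending the standard generator to an
element `x` with `x ^ m = 1`. -/
def cyclicLift {H : Type*} [Group H] (m : ℕ) (x : H) (hx : x ^ m = 1) :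
    Multiplicative (ZMod m) →* H :=
  AddMonoidHom.toMultiplicativeLeft
    (ZMod.lift m ⟨zmultiplesHom (Additive H) (Additive.ofMul x), by
      rw [zmultiplesHom_apply, natCast_zsmul, ← ofMul_pow, hx, ofMul_one]⟩)

theorem cyclicLift_ofAdd_one {H : Type*} [Group H] (m : ℕ) (x : H) (hx : x ^ m = 1) :
    cyclicLift m x hx (Multiplicative.ofAdd 1) = x := by
  have h := ZMod.lift_coe m ⟨zmultiplesHom (Additive H) (Additive.ofMul x), by
      rw [zmultiplesHom_apply, natCast_zsmul, ← ofMul_pow, hx, ofMul_one]⟩ 1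
  rw [Int.cast_one] at h
  change Additive.toMul (ZMod.lift m _ (1 : ZMod m)) = x
  rw [h]
  simp

/-- The matrix `S * T` of order `6` in `SL₂(ℤ)`; its class in `PSL₂(ℤ)` has order `3`. -/
def matU : SL(2, ℤ) := ModularGroup.S * ModularGroup.T

theorem coe_matU : (matU : Matrix (Fin 2) (Fin 2) ℤ) = !![0, -1; 1, 1] := by
  simp [matU, ModularGroup.coe_S, ModularGroup.coe_T]

theorem coe_matU_sq : ((matU ^ 2 : SL(2, ℤ)) : Matrix (Fin 2) (Fin 2) ℤ) = !![-1, -1; 1, 0] := by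
  rw [pow_two, Matrix.SpecialLinearGroup.coe_mul, coe_matU]
  simp

/-- The class of `S` in `PSL₂(ℤ)`. -/
def s : PSL(2, ℤ) := QuotientGroup.mk ModularGroup.S

/-- The class of `S * T` in `PSL₂(ℤ)`. -/
def u : PSL(2, ℤ) := QuotientGroup.mk matU

theorem mk_neg_one : (QuotientGroup.mk (-1 : SL(2, ℤ)) : PSL(2, ℤ)) = 1 := by
  rw [QuotientGroup.eq_one_iff, Matrix.SpecialLinearGroup.mem_center_iff]
  refine ⟨-1, by simp, ?_⟩
  simp

theorem s_sq : s ^ 2 = 1 := by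
  rw [s, ← QuotientGroup.mk_pow, ← mk_neg_one]
  congr 1
  ext i j
  fin_cases i <;> fin_cases j <;> simp [pow_two, ModularGroup.coe_S]

theorem u_cube : u ^ 3 = 1 := by
  rw [u, ← QuotientGroup.mk_pow, ← mk_neg_one]
  congr 1
  ext i j
  rw [pow_succ, Matrix.SpecialLinearGroup.coe_mul, coe_matU_sq, coe_matU]
  fin_cases i <;> fin_cases j <;> simp

theorem closure_s_u : Subgroup.closure {s, u} = (⊤ : Subgroup PSL(2, ℤ)) := by
  rw [eq_top_iff, ← MonoidHom.range_eq_top.mpr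
    (QuotientGroup.mk'_surjective (Subgroup.center SL(2, ℤ))), MonoidHom.range_eq_map,
    ← SpecialLinearGroup.SL2Z_generators, MonoidHom.map_closure, Subgroup.closure_le]
  have hs : s ∈ Subgroup.closure {s, u} := Subgroup.subset_closure (by simp)
  have hu : u ∈ Subgroup.closure {s, u} := Subgroup.subset_closure (by simp)
  rintro _ ⟨A, rfl | rfl, rfl⟩
  · exact hs
  · have : QuotientGroup.mk' (Subgroup.center SL(2, ℤ)) ModularGroup.T = s⁻¹ * u := by
      rw [s, u, matU, QuotientGroup.mk_mul, inv_mul_cancel_left]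
      rfl
    rw [this]
    exact mul_mem (inv_mem hs) hu

/-- The ping-pong sets: classes of matrices whose first column `(a, c)` satisfies `0 < ε * a * c`.
The condition is invariant under `A ↦ -A`. -/
def signSet (ε : ℤ) : Set PSL(2, ℤ) :=
  {g | ∃ A : SL(2, ℤ), QuotientGroup.mk A = g ∧ 0 < ε * (A 0 0 * A 1 0)}

theorem signSet_disjoint : Disjoint (signSet 1) (signSet (-1)) := by
  rw [Set.disjoint_left]
  rintro _ ⟨A, rfl, hA⟩ ⟨B, hBA, hB⟩
  obtain ⟨r, hr, h⟩ := Matrix.SpecialLinearGroup.mem_center_iff.mp (QuotientGroup.eq.mp hBA.symm)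
  rw [Fintype.card_fin] at hr
  have hBA' : (B : Matrix (Fin 2) (Fin 2) ℤ) = A * Matrix.scalar (Fin 2) r := by
    rw [h, ← Matrix.SpecialLinearGroup.coe_mul, mul_inv_cancel_left]
  have h0 : B 0 0 = A 0 0 * r := by
    rw [hBA', Matrix.scalar_apply, Matrix.mul_diagonal]
  have h1 : B 1 0 = A 1 0 * r := by
    rw [hBA', Matrix.scalar_apply, Matrix.mul_diagonal]
  have : B 0 0 * B 1 0 = A 0 0 * A 1 0 := by
    rw [h0, h1]; linear_combination A 0 0 * A 1 0 * hr
  rw [this] at hB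
  linarith

/-- On the ratio `x` of the entries of the first column, `s` acts as `x ↦ -1 / x`, while `u` and
`u²` act as `x ↦ -1 / (x + 1)` and `x ↦ -(x + 1) / x`. -/
theorem s_smul_signSet : s • signSet (-1) ⊆ signSet 1 := by
  rintro _ ⟨_, ⟨A, rfl, hA⟩, rfl⟩
  refine ⟨ModularGroup.S * A, rfl, ?_⟩
  rw [Matrix.SpecialLinearGroup.coe_mul, ModularGroup.coe_S]
  simp only [Matrix.mul_apply, Fin.sum_univ_two]
  simp
  linarith

theorem u_smul_signSet : u • signSet 1 ⊆ signSet (-1) := by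
  rintro _ ⟨_, ⟨A, rfl, hA⟩, rfl⟩
  refine ⟨matU * A, rfl, ?_⟩
  rw [Matrix.SpecialLinearGroup.coe_mul, coe_matU]
  simp only [Matrix.mul_apply, Fin.sum_univ_two]
  simp
  nlinarith [sq_nonneg (A 1 0)]

theorem u_sq_smul_signSet : u ^ 2 • signSet 1 ⊆ signSet (-1) := by
  rintro _ ⟨_, ⟨A, rfl, hA⟩, rfl⟩
  refine ⟨matU ^ 2 * A, rfl, ?_⟩
  rw [Matrix.SpecialLinearGroup.coe_mul, coe_matU_sq]
  simp only [Matrix.mul_apply, Fin.sum_univ_two]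
  simp
  nlinarith [sq_nonneg (A 0 0)]

/-- The orders of the two free factors of `PSL₂(ℤ)`. -/
abbrev factorOrder (b : Bool) : ℕ := cond b 3 2

/-- The inclusions of the two free factors into `PSL₂(ℤ)`. -/
def factorHom : ∀ b : Bool, Multiplicative (ZMod (factorOrder b)) →* PSL(2, ℤ)
  | false => cyclicLift 2 s s_sq
  | true => cyclicLift 3 u u_cube

theorem factorHom_false : factorHom false (Multiplicative.ofAdd (1 : ZMod 2)) = s :=
  cyclicLift_ofAdd_one 2 s s_sq

theorem factorHom_true : factorHom true (Multiplicative.ofAdd (1 : ZMod 3)) = u :=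
  cyclicLift_ofAdd_one 3 u u_cube

theorem lift_factorHom_injective : Function.Injective (Monoid.CoprodI.lift factorHom) := by
  refine Monoid.CoprodI.lift_injective_of_ping_pong factorHom (Or.inr ⟨true, ?_⟩)
    (fun b => signSet (cond b (-1) 1)) ?_ ?_ ?_
  · change (3 : Cardinal) ≤ Cardinal.mk (ZMod 3)
    rw [Cardinal.mk_fintype, ZMod.card]
    norm_num
  · rintro (_ | _)
    · refine ⟨_, ⟨!![1, 0; 1, 1], by simp⟩, rfl, by simp⟩
    · refine ⟨_, ⟨!![1, 0; -1, 1], by simp⟩, rfl, by simp⟩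
  · rintro (_ | _) (_ | _) h
    · exact absurd rfl h
    · exact signSet_disjoint
    · exact signSet_disjoint.symm
    · exact absurd rfl h
  · rintro (_ | _) (_ | _) h x hx
    · exact absurd rfl h
    · have : x = Multiplicative.ofAdd (1 : ZMod 2) := by
        exact (by decide : ∀ x : Multiplicative (ZMod 2), x ≠ 1 → x = Multiplicative.ofAdd 1) x hx
      rw [this, factorHom_false]
      exact s_smul_signSet
    · have : x = Multiplicative.ofAdd (1 : ZMod 3) ∨ x = Multiplicative.ofAdd (1 : ZMod 3) ^ 2 := by
        exact (by decide : ∀ x : Multiplicative (ZMod 3), x ≠ 1 →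
          x = Multiplicative.ofAdd 1 ∨ x = Multiplicative.ofAdd 1 ^ 2) x hx
      rcases this with rfl | rfl
      · rw [factorHom_true]
        exact u_smul_signSet
      · rw [map_pow, factorHom_true]
        exact u_sq_smul_signSet
    · exact absurd rfl h

theorem lift_factorHom_surjective : Function.Surjective (Monoid.CoprodI.lift factorHom) := by
  rw [← MonoidHom.range_eq_top, eq_top_iff, ← closure_s_u, Subgroup.closure_le]
  rintro _ (rfl | rfl)
  · exact ⟨Monoid.CoprodI.of (i := false) (Multiplicative.ofAdd (1 : ZMod 2)), by
      rw [Monoid.CoprodI.lift_of, factorHom_false]⟩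
  · exact ⟨Monoid.CoprodI.of (i := true) (Multiplicative.ofAdd (1 : ZMod 3)), by
      rw [Monoid.CoprodI.lift_of, factorHom_true]⟩

/-- `PSL₂(ℤ)` is presented by the generators `s`, `u` and the relations `s² = u³ = 1`. -/
theorem exists_hom_of_relations {H : Type*} [Group H] (x y : H) (hx : x ^ 2 = 1) (hy : y ^ 3 = 1) :
    ∃ φ : PSL(2, ℤ) →* H, φ s = x ∧ φ u = y := by
  let e := MulEquiv.ofBijective _ ⟨lift_factorHom_injective, lift_factorHom_surjective⟩
  let f : ∀ b : Bool, Multiplicative (ZMod (factorOrder b)) →* H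
    | false => cyclicLift 2 x hx
    | true => cyclicLift 3 y hy
  refine ⟨(Monoid.CoprodI.lift f).comp e.symm.toMonoidHom, ?_, ?_⟩
  · have h : e.symm s = Monoid.CoprodI.of (i := false) (Multiplicative.ofAdd (1 : ZMod 2)) := by
      rw [MulEquiv.symm_apply_eq]
      exact (by rw [Monoid.CoprodI.lift_of, factorHom_false] : s = Monoid.CoprodI.lift factorHom _)
    change Monoid.CoprodI.lift f (e.symm s) = x
    rw [h, Monoid.CoprodI.lift_of]
    exact cyclicLift_ofAdd_one _ _ _
  · have h : e.symm u = Monoid.CoprodI.of (i := true) (Multiplicative.ofAdd (1 : ZMod 3)) := by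
      rw [MulEquiv.symm_apply_eq]
      exact (by rw [Monoid.CoprodI.lift_of, factorHom_true] : u = Monoid.CoprodI.lift factorHom _)
    change Monoid.CoprodI.lift f (e.symm u) = y
    rw [h, Monoid.CoprodI.lift_of]
    exact cyclicLift_ofAdd_one _ _ _

/-! ### Ranks and traces of quasi-idempotents -/

/-- Rank–nullity, in the form that needs only a domain of scalars. -/
theorem finrank_range_add_finrank_ker_of_isDomain {R V W : Type*} [CommRing R] [IsDomain R]
    [AddCommGroup V] [Module R V] [Module.Finite R V] [AddCommGroup W] [Module R W]
    (f : V →ₗ[R] W) :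
    Module.finrank R (LinearMap.range f) + Module.finrank R (LinearMap.ker f) =
      Module.finrank R V := by
  rw [← f.quotKerEquivRange.finrank_eq]
  exact Submodule.finrank_quotient_add_finrank _

/-- An operator with `N² = c N` factors through its image, on which it acts as `c`. -/
theorem trace_eq_mul_finrank_range {V : Type*} [AddCommGroup V] [Module.Finite ℤ V]
    [Module.Free ℤ V] (N : Module.End ℤ V) (c : ℤ) (hN : N * N = c • N) :
    LinearMap.trace ℤ V N = c * Module.finrank ℤ (LinearMap.range N) := by
  have h : N = (LinearMap.range N).subtype ∘ₗ N.rangeRestrict := rfl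
  have h' : N.rangeRestrict ∘ₗ (LinearMap.range N).subtype = c • LinearMap.id := by
    ext ⟨_, x, rfl⟩
    exact LinearMap.congr_fun hN x
  conv_lhs => rw [h]
  rw [LinearMap.trace_comp_comm', h', map_smul, LinearMap.trace_id, smul_eq_mul]

/-- The trace of an operator with `N² = c N` determines the rank of its kernel. -/
theorem mul_finrank_ker_add_trace {V : Type*} [AddCommGroup V] [Module.Finite ℤ V]
    [Module.Free ℤ V] (N : Module.End ℤ V) (c : ℤ) (hN : N * N = c • N) :
    c * Module.finrank ℤ (LinearMap.ker N) + LinearMap.trace ℤ V N = c * Module.finrank ℤ V := by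
  rw [trace_eq_mul_finrank_range N c hN, ← finrank_range_add_finrank_ker_of_isDomain N]
  push_cast
  ring

/-! ### Cocycles and the two norm operators -/

section Cocycles

variable {V : Type} [AddCommGroup V] (ρ : Representation ℤ PSL(2, ℤ) V)

/-- The action of `PSL₂(ℤ)` by automorphisms of the additive group of a representation. -/
def toMulAut : PSL(2, ℤ) →* MulAut (Multiplicative V) where
  toFun g := AddEquiv.toMultiplicative
    { toFun := ρ g
      invFun := ρ g⁻¹
      left_inv := ρ.inv_self_apply g
      right_inv := ρ.self_inv_apply g
      map_add' := map_add (ρ g) }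
  map_one' := by ext x; simp
  map_mul' g h := by ext x; simp

/-- The norm operator `1 + s` of the subgroup of order `2`. -/
def normS : Module.End ℤ V := 1 + ρ s

/-- The norm operator `1 + u + u²` of the subgroup of order `3`. -/
def normU : Module.End ℤ V := 1 + ρ u + ρ (u ^ 2)

theorem normS_mul_self : normS ρ * normS ρ = (2 : ℤ) • normS ρ := by
  have h : ρ s * ρ s = 1 := by rw [← map_mul, ← pow_two, s_sq, map_one]
  rw [normS, mul_add, add_mul, add_mul, h, two_smul]
  simp only [mul_one, one_mul]
  abel

theorem normU_mul_self : normU ρ * normU ρ = (3 : ℤ) • normU ρ := by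
  have h1 : ρ u * ρ (u ^ 2) = 1 := by rw [← map_mul, ← pow_succ', u_cube, map_one]
  have h2 : ρ (u ^ 2) * ρ u = 1 := by rw [← map_mul, ← pow_succ, u_cube, map_one]
  have h3 : ρ u * ρ u = ρ (u ^ 2) := by rw [← map_mul, ← pow_two]
  have h4 : ρ (u ^ 2) * ρ (u ^ 2) = ρ u := by
    rw [← map_mul, ← pow_add, show 2 + 2 = 3 + 1 from rfl, pow_succ, u_cube, one_mul]
  simp only [normU, mul_add, add_mul, h1, h2, h3, h4, mul_one, one_mul]
  rw [show (3 : ℤ) = 1 + 1 + 1 from rfl, add_smul, add_smul, one_smul]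
  abel

open groupCohomology

/-- A cocycle is determined by its values at `s` and `u`, which lie in the kernels of the norms. -/
def evalCocycle : cocycles₁ (Rep.of ρ) →ₗ[ℤ] LinearMap.ker (normS ρ) × LinearMap.ker (normU ρ) :=
  LinearMap.prod
    (LinearMap.codRestrict _ (LinearMap.proj s ∘ₗ Submodule.subtype _) fun f => by
      have hf := (mem_cocycles₁_iff f.1).mp f.2
      have h1 := cocycles₁_map_one f
      have := hf s s
      rw [← pow_two, s_sq] at this
      rw [LinearMap.mem_ker]
      change f.1 s + ρ s (f.1 s) = 0
      rw [add_comm]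
      exact this.symm.trans h1)
    (LinearMap.codRestrict _ (LinearMap.proj u ∘ₗ Submodule.subtype _) fun f => by
      have hf := (mem_cocycles₁_iff f.1).mp f.2
      have h1 := cocycles₁_map_one f
      have := hf (u ^ 2) u
      rw [← pow_succ, u_cube, pow_two u, hf u u] at this
      rw [LinearMap.mem_ker]
      change f.1 u + ρ u (f.1 u) + ρ (u ^ 2) (f.1 u) = 0
      rw [pow_two, add_comm, add_comm (f.1 u)]
      exact this.symm.trans h1)

theorem evalCocycle_injective : Function.Injective (evalCocycle ρ) := by
  rw [← LinearMap.ker_eq_bot, LinearMap.ker_eq_bot']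
  intro f hf
  have hs : f.1 s = 0 := congrArg (fun p => (p.1 : V)) hf
  have hu : f.1 u = 0 := congrArg (fun p => (p.2 : V)) hf
  have hc := (mem_cocycles₁_iff f.1).mp f.2
  refine cocycles₁_ext fun g => ?_
  change f.1 g = 0
  have hg : g ∈ Subgroup.closure {s, u} := closure_s_u ▸ Subgroup.mem_top g
  induction hg using Subgroup.closure_induction with
  | mem x hx => rcases hx with rfl | rfl <;> assumption
  | one => exact cocycles₁_map_one f
  | mul x y _ _ hx hy => rw [hc, hx, hy, map_zero, add_zero]
  | inv x _ hx =>
    have h := hc x⁻¹ x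
    rw [hx, map_zero, zero_add, inv_mul_cancel] at h
    exact h.symm.trans (cocycles₁_map_one f)

/-- A homomorphism to the semidirect product that is a section of the projection has a cocycle as
its left component; the presentation of `PSL₂(ℤ)` supplies such a homomorphism for any prescribed
values at `s` and `u` killed by the norms. -/
theorem evalCocycle_surjective : Function.Surjective (evalCocycle ρ) := by
  rintro ⟨⟨a, ha⟩, ⟨b, hb⟩⟩
  replace ha : a + ρ s a = 0 := ha
  replace hb : b + ρ u b + ρ (u ^ 2) b = 0 := hb
  obtain ⟨φ, hφs, hφu⟩ := exists_hom_of_relations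
    (⟨Multiplicative.ofAdd a, s⟩ : Multiplicative V ⋊[toMulAut ρ] PSL(2, ℤ))
    ⟨Multiplicative.ofAdd b, u⟩
    (by
      rw [pow_two]
      refine SemidirectProduct.ext ha ?_
      exact (pow_two s).symm.trans s_sq)
    (by
      rw [pow_succ, pow_two]
      refine SemidirectProduct.ext ?_ ?_
      · change b + ρ u b + ρ (u * u) b = 0
        rw [← pow_two, hb]
      · change u * u * u = 1
        rw [← pow_two, ← pow_succ, u_cube])
  have hright : ∀ g, (φ g).right = g := by
    have : SemidirectProduct.rightHom.comp φ = MonoidHom.id _ := by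
      refine MonoidHom.eq_of_eqOn_dense closure_s_u ?_
      rintro _ (rfl | rfl)
      · simp [hφs]
      · simp [hφu]
    exact fun g => DFunLike.congr_fun this g
  refine ⟨⟨fun g => Multiplicative.toAdd (φ g).left, ?_⟩, ?_⟩
  · rw [mem_cocycles₁_iff]
    intro g h
    rw [map_mul, SemidirectProduct.mul_left, hright, add_comm]
    rfl
  · refine Prod.ext (Subtype.ext ?_) (Subtype.ext ?_)
    · exact congrArg (fun x => Multiplicative.toAdd x.left) hφs
    · exact congrArg (fun x => Multiplicative.toAdd x.left) hφu

theorem H1π_surjective (A : Rep ℤ PSL(2, ℤ)) : Function.Surjective (H1π A).hom :=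
  (ModuleCat.epi_iff_surjective _).mp inferInstance

section Rank

variable [Module.Finite ℤ V]

theorem cocycles₁_finite : Module.Finite ℤ (cocycles₁ (Rep.of ρ)) :=
  Module.Finite.of_injective _ (evalCocycle_injective ρ)

theorem H1_finite : Module.Finite ℤ (H1 (Rep.of ρ)) :=
  have := cocycles₁_finite ρ
  Module.Finite.of_surjective _ (H1π_surjective (Rep.of ρ))

variable [Module.Free ℤ V]

/-- Without invariants the coboundaries have the rank of `V`. -/
theorem finrank_H1_add (hinv : ρ.invariants = ⊥) :
    Module.finrank ℤ (H1 (Rep.of ρ)) + Module.finrank ℤ V =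
      Module.finrank ℤ (LinearMap.ker (normS ρ)) + Module.finrank ℤ (LinearMap.ker (normU ρ)) := by
  have := cocycles₁_finite ρ
  have := H1_finite ρ
  have hB : Module.finrank ℤ V = Module.finrank ℤ (LinearMap.ker (H1π (Rep.of ρ)).hom) := by
    have hker : LinearMap.ker (H1π (Rep.of ρ)).hom =
        (coboundaries₁ (Rep.of ρ)).comap (cocycles₁ (Rep.of ρ)).subtype := by
      ext x
      exact H1π_eq_zero_iff x
    have hd : LinearMap.ker (d₀₁ (Rep.of ρ)).hom = ⊥ := by
      rw [d₀₁_ker_eq_invariants]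
      exact hinv
    rw [hker, (Submodule.comapSubtypeEquivOfLe (coboundaries₁_le_cocycles₁ (Rep.of ρ))).finrank_eq]
    exact (LinearEquiv.ofInjective _ (LinearMap.ker_eq_bot.mp hd)).finrank_eq
  have hZ : Module.finrank ℤ (cocycles₁ (Rep.of ρ)) =
      Module.finrank ℤ (LinearMap.ker (normS ρ)) + Module.finrank ℤ (LinearMap.ker (normU ρ)) := by
    rw [(LinearEquiv.ofBijective _
      ⟨evalCocycle_injective ρ, evalCocycle_surjective ρ⟩).finrank_eq, Module.finrank_prod]
  have h := finrank_range_add_finrank_ker_of_isDomain (H1π (Rep.of ρ)).hom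
  rw [LinearMap.range_eq_top.mpr (H1π_surjective (Rep.of ρ)), finrank_top, ← hB] at h
  exact h.trans hZ

end Rank

end Cocycles

/-! ### The monomial basis and traces on binary forms -/

/-- The exponent of the monomial `X ^ i * Y ^ (n - i)`. -/
noncomputable def monomialExp (n : ℕ) (i : Fin (n + 1)) : Fin 2 →₀ ℕ :=
  Finsupp.single 0 (i : ℕ) + Finsupp.single 1 (n - i)

@[simp]
theorem monomialExp_zero (n : ℕ) (i : Fin (n + 1)) : monomialExp n i 0 = i := by
  simp [monomialExp]

@[simp]
theorem monomialExp_one (n : ℕ) (i : Fin (n + 1)) : monomialExp n i 1 = n - i := by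
  simp [monomialExp]

theorem apply_zero_add_apply_one {n : ℕ} {P : MvPolynomial (Fin 2) ℤ} (hP : P.IsHomogeneous n)
    {d : Fin 2 →₀ ℕ} (hd : P.coeff d ≠ 0) : d 0 + d 1 = n := by
  have h := hP hd
  rw [Pi.one_def, ← Finsupp.degree_eq_weight_one, Finsupp.degree_eq_sum, Fin.sum_univ_two] at h
  exact h

theorem eq_monomialExp_iff {n : ℕ} {d : Fin 2 →₀ ℕ} (hd : d 0 + d 1 = n) (i : Fin (n + 1)) :
    d = monomialExp n i ↔ d 0 = i := by
  constructor
  · rintro rfl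
    simp
  · intro h
    ext j
    fin_cases j
    · simpa using h
    · simp
      omega

theorem isHomogeneous_monomial_monomialExp (n : ℕ) (i : Fin (n + 1)) (c : ℤ) :
    (MvPolynomial.monomial (monomialExp n i) c).IsHomogeneous n := by
  refine MvPolynomial.isHomogeneous_monomial _ ?_
  rw [Finsupp.degree_eq_sum, Fin.sum_univ_two]
  have := i.2
  simp
  omega

/-- The coordinates of a binary form of degree `n` are its coefficients. -/
noncomputable def coeffEquiv (n : ℕ) : HomPoly n ≃ₗ[ℤ] (Fin (n + 1) → ℤ) where
  toFun P i := (P : MvPolynomial (Fin 2) ℤ).coeff (monomialExp n i)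
  map_add' P Q := by ext; simp
  map_smul' c P := by ext; exact MvPolynomial.coeff_smul _ c _
  invFun c := ⟨∑ i, MvPolynomial.monomial (monomialExp n i) (c i),
    MvPolynomial.IsHomogeneous.sum _ _ _ fun i _ => isHomogeneous_monomial_monomialExp n i _⟩
  left_inv P := by
    ext d
    simp only [MvPolynomial.coeff_sum, MvPolynomial.coeff_monomial]
    by_cases hd : d 0 + d 1 = n
    · rw [Finset.sum_eq_single ⟨d 0, by omega⟩]
      · rw [if_pos ((eq_monomialExp_iff hd _).mpr rfl).symm,
          ← (eq_monomialExp_iff hd ⟨d 0, by omega⟩).mpr rfl]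
      · intro i _ hi
        rw [if_neg]
        intro h
        exact hi (Fin.ext ((eq_monomialExp_iff hd i).mp h.symm).symm)
      · simp
    · rw [Finset.sum_eq_zero]
      · by_contra h
        exact hd (apply_zero_add_apply_one P.2 (Ne.symm h))
      · intro i _
        rw [if_neg]
        rintro rfl
        have := i.2
        simp at hd
        omega
  right_inv c := by
    ext i
    simp only [MvPolynomial.coeff_sum, MvPolynomial.coeff_monomial]
    rw [Finset.sum_eq_single i]
    · simp
    · intro j _ hj
      rw [if_neg]
      intro h
      have := DFunLike.congr_fun h 0
      simp only [monomialExp_zero] at this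
      exact hj (Fin.ext this)
    · simp

/-- The basis of monomials `X ^ i * Y ^ (n - i)`. -/
noncomputable def monomialBasis (n : ℕ) : Module.Basis (Fin (n + 1)) ℤ (HomPoly n) :=
  Module.Basis.ofEquivFun (coeffEquiv n)

theorem coe_monomialBasis (n : ℕ) (i : Fin (n + 1)) :
    (monomialBasis n i : MvPolynomial (Fin 2) ℤ) =
      MvPolynomial.X 0 ^ (i : ℕ) * MvPolynomial.X 1 ^ (n - i : ℕ) := by
  have h : monomialBasis n i =
      ⟨_, isHomogeneous_monomial_monomialExp n i 1⟩ := by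
    rw [monomialBasis, Module.Basis.coe_ofEquivFun, LinearEquiv.symm_apply_eq]
    ext j
    change _ = MvPolynomial.coeff _ (MvPolynomial.monomial _ _)
    rw [MvPolynomial.coeff_monomial, Pi.single_apply]
    refine if_congr ⟨fun h => h ▸ rfl, fun h => ?_⟩ rfl rfl
    have := DFunLike.congr_fun h 0
    simp only [monomialExp_zero] at this
    exact Fin.ext this.symm
  rw [h]
  change MvPolynomial.monomial (monomialExp n i) (1 : ℤ) = _
  rw [MvPolynomial.monomial_eq, Finsupp.prod_fintype _ _ fun _ => pow_zero _]
  simp [Fin.prod_univ_two]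

/-- Dehomogenization `P(X, Y) ↦ P(X, 1)`. -/
noncomputable def dehomog : MvPolynomial (Fin 2) ℤ →ₐ[ℤ] Polynomial ℤ :=
  MvPolynomial.aeval ![Polynomial.X, 1]

/-- In a fixed degree, setting `Y = 1` loses none of the coefficients. -/
theorem coeff_dehomog {n : ℕ} (P : HomPoly n) (i : Fin (n + 1)) :
    (dehomog P).coeff i = (monomialBasis n).repr P i := by
  conv_lhs => rw [← (monomialBasis n).sum_repr P]
  simp only [Submodule.coe_sum, Submodule.coe_smul, map_sum, map_smul, coe_monomialBasis, map_mul,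
    map_pow, Polynomial.finsetSum_coeff, Polynomial.coeff_smul]
  simp [dehomog, Polynomial.coeff_X_pow, Fin.val_inj]

instance (n : ℕ) : Module.Free ℤ (HomPoly n) := Module.Free.of_basis (monomialBasis n)

instance (n : ℕ) : Module.Finite ℤ (HomPoly n) := Module.Finite.of_basis (monomialBasis n)

theorem finrank_homPoly (n : ℕ) : Module.finrank ℤ (HomPoly n) = n + 1 := by
  rw [Module.finrank_eq_card_basis (monomialBasis n), Fintype.card_fin]

open Polynomial in
theorem trace_rhoSL (n : ℕ) (A : SL(2, ℤ)) :
    LinearMap.trace ℤ (HomPoly n) (rhoSL n A) = ∑ p ∈ Finset.HasAntidiagonal.antidiagonal n,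
      ((C (A 0 0) * X + C (A 1 0)) ^ p.1 * (C (A 0 1) * X + C (A 1 1)) ^ p.2 : ℤ[X]).coeff p.1 := by
  rw [LinearMap.trace_eq_matrix_trace ℤ (monomialBasis n), Matrix.trace,
    Finset.Nat.sum_antidiagonal_eq_sum_range_succ
      (fun i j =>
        ((C (A 0 0) * X + C (A 1 0)) ^ i * (C (A 0 1) * X + C (A 1 1)) ^ j : ℤ[X]).coeff i),
    Finset.sum_range]
  refine Finset.sum_congr rfl fun i _ => ?_
  rw [Matrix.diag_apply, LinearMap.toMatrix_apply, ← coeff_dehomog]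
  change (dehomog (polySubst _ (monomialBasis n i : MvPolynomial (Fin 2) ℤ))).coeff i = _
  rw [coe_monomialBasis]
  simp [dehomog, polySubst]

/-! ### The traces of the two generators -/

open Polynomial in
theorem neg_X_pow_eq (j : ℕ) : (-X : ℤ[X]) ^ j = C ((-1) ^ j) * X ^ j := by
  rw [neg_pow, C_pow, C_neg, C_1]

open Polynomial in
theorem trace_rhoSL_S (m : ℕ) :
    LinearMap.trace ℤ (HomPoly (2 * m)) (rhoSL (2 * m) ModularGroup.S) = (-1) ^ m := by
  have hterm : ∀ p : ℕ × ℕ,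
      ((C (ModularGroup.S 0 0) * X + C (ModularGroup.S 1 0)) ^ p.1 *
        (C (ModularGroup.S 0 1) * X + C (ModularGroup.S 1 1)) ^ p.2 : ℤ[X]).coeff p.1 =
          if p.1 = p.2 then (-1) ^ p.2 else 0 := fun p => by
    have : Polynomial.C (ModularGroup.S 0 1) * Polynomial.X + Polynomial.C (ModularGroup.S 1 1) =
        (-Polynomial.X : Polynomial ℤ) := by simp [ModularGroup.coe_S]
    rw [this, neg_X_pow_eq]
    simp only [ModularGroup.coe_S]
    simp only [Matrix.of_apply, Matrix.cons_val', Matrix.cons_val_zero, Matrix.cons_val_one,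
      map_zero, zero_mul, zero_add, map_one, one_pow, one_mul, Polynomial.coeff_C_mul,
      Polynomial.coeff_X_pow, mul_ite, mul_one, mul_zero]
  rw [trace_rhoSL, Finset.sum_eq_single (m, m)]
  · rw [hterm, if_pos rfl]
  · rintro ⟨i, j⟩ hij h
    rw [Finset.HasAntidiagonal.mem_antidiagonal] at hij
    rw [hterm, if_neg]
    intro hij'
    refine h (Prod.ext ?_ ?_) <;> simp only at * <;> omega
  · intro h
    exact absurd (Finset.HasAntidiagonal.mem_antidiagonal.mpr (by ring)) h

/-- The alternating sum of the binomial coefficients on a shallow diagonal of Pascal's triangle. -/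
def altDiagSum (n : ℕ) : ℤ :=
  ∑ p ∈ Finset.HasAntidiagonal.antidiagonal n, (-1) ^ p.1 * (p.2.choose p.1 : ℤ)

/-- Pascal's rule, as in the expression of the Fibonacci numbers as shallow diagonal sums. -/
theorem altDiagSum_add_two (n : ℕ) : altDiagSum (n + 2) = altDiagSum (n + 1) - altDiagSum n := by
  rw [altDiagSum, altDiagSum, altDiagSum, Finset.Nat.antidiagonal_succ_succ',
    Finset.Nat.antidiagonal_succ]
  simp [Nat.choose_succ_succ, Finset.sum_add_distrib, mul_add, pow_succ]
  ring

theorem altDiagSum_two_mul (m : ℕ) : altDiagSum (2 * m) = eta (2 * m) := by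
  have h3 : ∀ k, altDiagSum (k + 3) = - altDiagSum k := fun k => by
    rw [altDiagSum_add_two, altDiagSum_add_two]; ring
  have h0 : altDiagSum 0 = 1 := by rw [altDiagSum]; decide
  have h2 : altDiagSum 2 = 0 := by rw [altDiagSum]; decide
  have h4 : altDiagSum 4 = -1 := by rw [altDiagSum]; decide
  induction m using Nat.strong_induction_on with
  | _ m ih =>
    match m with
    | 0 => rw [mul_zero, h0]; rfl
    | 1 => rw [mul_one, h2]; rfl
    | 2 => rw [h4]; rfl
    | k + 3 =>
      rw [show 2 * (k + 3) = 2 * k + 3 + 3 by ring, h3, h3, neg_neg, ih k (by omega)]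
      simp [eta]

open Polynomial in
theorem coeff_one_sub_X_pow (i j : ℕ) :
    ((-X + 1 : ℤ[X]) ^ j).coeff i = (-1) ^ i * (j.choose i : ℤ) := by
  have : (-X + 1 : ℤ[X]) ^ j = ((1 + X) ^ j).comp (C (-1) * X) := by
    simp [add_comm]
  rw [this, comp_C_mul_X_coeff, coeff_one_add_X_pow, mul_comm]

theorem trace_rhoSL_U (n : ℕ) :
    LinearMap.trace ℤ (HomPoly n) (rhoSL n matU) = altDiagSum n := by
  rw [trace_rhoSL, altDiagSum]
  refine Finset.sum_congr rfl fun p _ => ?_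
  simp [coe_matU, coeff_one_sub_X_pow]

theorem trace_rhoSL_U_sq (m : ℕ) :
    LinearMap.trace ℤ (HomPoly (2 * m)) (rhoSL (2 * m) (matU ^ 2)) = altDiagSum (2 * m) := by
  rw [trace_rhoSL, altDiagSum, ← Finset.Nat.sum_antidiagonal_swap]
  refine Finset.sum_congr rfl fun p hp => ?_
  rw [Finset.HasAntidiagonal.mem_antidiagonal] at hp
  have h0 : Polynomial.C ((matU ^ 2 : SL(2, ℤ)) 0 0) * Polynomial.X +
      Polynomial.C ((matU ^ 2 : SL(2, ℤ)) 1 0) = (-Polynomial.X + 1 : Polynomial ℤ) := by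
    rw [coe_matU_sq]; simp
  have h1 : Polynomial.C ((matU ^ 2 : SL(2, ℤ)) 0 1) * Polynomial.X +
      Polynomial.C ((matU ^ 2 : SL(2, ℤ)) 1 1) = (-Polynomial.X : Polynomial ℤ) := by
    rw [coe_matU_sq]; simp
  rw [h0, h1, neg_X_pow_eq, Prod.fst_swap, Prod.snd_swap, mul_left_comm, Polynomial.coeff_C_mul,
    Polynomial.coeff_mul_X_pow']
  split_ifs with h
  · have hsign : (-1 : ℤ) ^ (p.2 - p.1) = 1 := Even.neg_one_pow ⟨m - p.1, by omega⟩
    rw [coeff_one_sub_X_pow, hsign, one_mul, Nat.choose_symm h]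
  · rw [Nat.choose_eq_zero_of_lt (by omega)]
    simp

/-! ### Invariants -/

theorem eval_polySubst (A : Matrix (Fin 2) (Fin 2) ℤ) (P : MvPolynomial (Fin 2) ℤ) (v : Fin 2 → ℤ) :
    MvPolynomial.eval v (polySubst A P) = MvPolynomial.eval (Matrix.vecMul v A) P := by
  have h : (MvPolynomial.aeval v : MvPolynomial (Fin 2) ℤ →ₐ[ℤ] ℤ).comp (polySubst A) =
      MvPolynomial.aeval (Matrix.vecMul v A) := by
    ext j
    simp [polySubst, Matrix.vecMul, dotProduct, Fin.sum_univ_two, mul_comm]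
  exact DFunLike.congr_fun h P

theorem eval_dehomog (P : MvPolynomial (Fin 2) ℤ) (x : ℤ) :
    (dehomog P).eval x = MvPolynomial.eval ![x, 1] P := by
  have h : (Polynomial.aeval x : Polynomial ℤ →ₐ[ℤ] ℤ).comp dehomog =
      MvPolynomial.aeval ![x, 1] := by
    ext j
    fin_cases j <;> simp [dehomog]
  exact DFunLike.congr_fun h P

theorem invariants_rhoPSL {n : ℕ} (hpos : 1 ≤ n) (hn : Even n) : (rhoPSL n hn).invariants = ⊥ := by
  rw [eq_bot_iff]
  intro P hP
  have hinv : ∀ (A : SL(2, ℤ)) (v : Fin 2 → ℤ), MvPolynomial.eval (Matrix.vecMul v A) P.1 =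
      MvPolynomial.eval v P.1 := fun A v => by
    rw [← eval_polySubst]
    exact congrArg (fun Q : HomPoly n => MvPolynomial.eval v Q.1) (hP (QuotientGroup.mk A))
  -- The lower unipotent matrices carry `(0, 1)` to every `(x, 1)`.
  have hconst : dehomog P.1 = Polynomial.C (MvPolynomial.eval ![0, 1] P.1) := by
    refine Polynomial.funext fun x => ?_
    rw [eval_dehomog, Polynomial.eval_C,
      ← hinv ⟨!![1, 0; x, 1], by simp⟩ ![0, 1]]
    simp
  have hrepr : ∀ i : Fin n, (monomialBasis n).repr P i.succ = 0 := fun i => by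
    rw [← coeff_dehomog, hconst, Polynomial.coeff_C, if_neg (by simp)]
  have hP0 : P = (monomialBasis n).repr P 0 • monomialBasis n 0 := by
    conv_lhs => rw [← (monomialBasis n).sum_repr P, Fin.sum_univ_succ]
    simp [hrepr]
  -- `S` carries `(0, 1)` to `(1, 0)`, where `Y ^ n` vanishes.
  have hS := hinv ModularGroup.S ![0, 1]
  rw [hP0] at hS
  simp [coe_monomialBasis, ModularGroup.coe_S, show n ≠ 0 by omega] at hS
  rw [Submodule.mem_bot, hP0, ← hS, zero_smul]

/-! ### The rank formula -/

theorem trace_normS (m : ℕ) (hn : Even (2 * m)) :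
    LinearMap.trace ℤ _ (normS (rhoPSL (2 * m) hn)) = 2 * m + 1 + (-1) ^ m := by
  have h : rhoPSL (2 * m) hn s = rhoSL (2 * m) ModularGroup.S := rfl
  rw [normS, map_add, LinearMap.trace_one, h, trace_rhoSL_S, finrank_homPoly]
  push_cast
  ring

theorem trace_normU (m : ℕ) (hn : Even (2 * m)) :
    LinearMap.trace ℤ _ (normU (rhoPSL (2 * m) hn)) = 2 * m + 1 + 2 * eta (2 * m) := by
  have h : rhoPSL (2 * m) hn u = rhoSL (2 * m) matU := rfl
  have h2 : rhoPSL (2 * m) hn (u ^ 2) = rhoSL (2 * m) (matU ^ 2) := rfl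
  rw [normU, map_add, map_add, LinearMap.trace_one, h, h2, trace_rhoSL_U, trace_rhoSL_U_sq,
    altDiagSum_two_mul, finrank_homPoly]
  push_cast
  ring

theorem six_mul_finrank_H1 (m : ℕ) (hpos : 1 ≤ 2 * m) (hn : Even (2 * m)) :
    6 * (Module.finrank ℤ (groupCohomology.H1 (Rep.of (rhoPSL (2 * m) hn))) : ℤ) =
      2 * m + 1 - 3 * (-1) ^ m - 4 * eta (2 * m) := by
  have h := congrArg (Nat.cast (R := ℤ))
    (finrank_H1_add (rhoPSL (2 * m) hn) (invariants_rhoPSL hpos hn))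
  have hS := mul_finrank_ker_add_trace _ 2 (normS_mul_self (rhoPSL (2 * m) hn))
  have hU := mul_finrank_ker_add_trace _ 3 (normU_mul_self (rhoPSL (2 * m) hn))
  rw [trace_normS] at hS
  rw [trace_normU] at hU
  rw [finrank_homPoly] at h hS hU
  push_cast at h hS hU
  linear_combination 6 * h + 3 * hS + 2 * hU

end PSLCohomology

theorem theorem6p2 (n : ℕ) (hpos : 1 ≤ n) (hn : Even n) :
    Module.Finite ℤ (groupCohomology.H1 (Rep.of (rhoPSL n hn))) ∧
    (Module.finrank ℤ (groupCohomology.H1 (Rep.of (rhoPSL n hn))) : ℚ) =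
      ((n : ℚ) + 1 + 3 * (-1 : ℚ) ^ (n / 2 + 1) - 4 * (eta n : ℚ)) / 6 ∧
    0 < ((n : ℚ) + 1 + 3 * (-1 : ℚ) ^ (n / 2 + 1) - 4 * (eta n : ℚ)) / 6 ∧
    ((n : ℚ) - 6) / 6 ≤ (Module.finrank ℤ (groupCohomology.H1 (Rep.of (rhoPSL n hn))) : ℚ) := by
  obtain ⟨m, rfl⟩ := hn.two_dvd
  have hrank := PSLCohomology.six_mul_finrank_H1 m hpos hn
  have heta : eta (2 * m) ≤ 1 := by rw [eta]; split_ifs <;> decide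
  have hsign : (-1 : ℤ) ^ m ≤ 1 := by
    rcases neg_one_pow_eq_or ℤ m with h | h <;> simp [h]
  have hrankQ := congrArg (Int.cast (R := ℚ)) hrank
  have hdiv : 2 * m / 2 = m := by omega
  rw [hdiv, pow_succ]
  push_cast at hrankQ ⊢
  have heq : (Module.finrank ℤ (groupCohomology.H1 (Rep.of (rhoPSL (2 * m) hn))) : ℚ) =
      (2 * (m : ℚ) + 1 + 3 * ((-1 : ℚ) ^ m * -1) - 4 * (eta (2 * m) : ℚ)) / 6 := by
    linear_combination hrankQ / 6
  refine ⟨PSLCohomology.H1_finite _, heq, ?_, ?_⟩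
  · rw [← heq, Nat.cast_pos]
    -- The crude bounds on `η` and on the sign give `6 * rank ≥ 2 * m - 6`, which settles `4 ≤ m`.
    rcases lt_or_ge m 4 with hm | hm
    · interval_cases m
      · omega
      · norm_num [show eta (2 * 1) = 0 from rfl] at hrank
        omega
      · norm_num [show eta (2 * 2) = -1 from rfl] at hrank
        omega
      · norm_num [show eta (2 * 3) = 1 from rfl] at hrank
        omega
    · omega
  · have hetaQ : (eta (2 * m) : ℚ) ≤ 1 := by exact_mod_cast heta
    have hsignQ : (-1 : ℚ) ^ m ≤ 1 := by exact_mod_cast hsign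
    rw [heq]
    linarith
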